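/- Let $F$ be Thompson's group of orientation-preserving homeomorphisms of $[0,1]$ that are piecewise linear with finitely many breakpoints, all at dyadic rationals, and with slopes that are powers of $2$. Let $T$ be the group of orientation-preserving homeomorphisms of the circle $\mathbb R/\mathbb Z$ that are piecewise linear with finitely many breakpoints, all at dyadic points, have slopes that are powers of $2$, and map the set of dyadic points onto itself. Products are compositions. Identifying the endpoints of $[0,1]$ embeds $F$ in $T$. Let $x_0,x_1\in F$ and $c_0\in T$ be the standard elements: $x_0$ maps $[0,\frac12],[\frac12,\frac34],[\frac34,1]$ affinely and increasingly onto $[0,\frac14],[\frac14,\frac12],[\frac12,1]$ respectively; $x_1$ is the identity on $[0,\frac12]$ and maps $[\frac12,\frac34],[\frac34,\frac78],[\frac78,1]$ affinely and increasingly onto $[\frac12,\frac58],[\frac58,\frac34],[\frac34,1]$ respectively; $c_0$ is the rotation of the circle by $\frac12$. A finite rooted binary tree describes a subdivision of $[0,1]$ into dyadic intervals, one for each leaf: each caret (a node with its two downward edges) halves the interval of its node. A tree pair diagram is a pair of finite rooted binary trees with the same number of leaves. It represents $w\in F$ if, for each $i$, $w$ maps the interval of the $i$-th leaf of the first tree (counted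 from the left) affinely and increasingly onto the interval of the $i$-th leaf of the second tree. It is reduced if there is no $i$ such that in both trees the leaves $i$ and $i+1$ are the two leaves of a single caret. Each $w\in F$ is represented by exactly one reduced tree pair diagram; let $N(w)$ be the number of carets of either tree in it. Let $|w|_F$ be the word length of $w$ in $F$ with respect to $\{x_0,x_1\}$, and $|w|_T$ its word length in $T$ with respect to $\{x_0,x_1,c_0\}$. Theorem. If $w\in F$ satisfies $N(w)\ge |w|_F+1$, then $|w|_T=|w|_F$. -/

import Mathlib

open scoped unitInterval Topology

namespace Thompson

/-! ### Dyadic rationals -/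

/-- A real number is a dyadic rational if it is of the form `m / 2 ^ n`. -/
def IsDyadic (r : ℝ) : Prop := ∃ (m : ℤ) (n : ℕ), r = m / 2 ^ n

theorem IsDyadic.add {r s : ℝ} (hr : IsDyadic r) (hs : IsDyadic s) : IsDyadic (r + s) := by
  obtain ⟨m, n, rfl⟩ := hr
  obtain ⟨k, l, rfl⟩ := hs
  refine ⟨m * 2 ^ l + k * 2 ^ n, n + l, ?_⟩
  push_cast
  rw [pow_add]
  field_simp

theorem IsDyadic.neg {r : ℝ} (hr : IsDyadic r) : IsDyadic (-r) := by
  obtain ⟨m, n, rfl⟩ := hr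
  exact ⟨-m, n, by push_cast; ring⟩

theorem IsDyadic.half {r : ℝ} (hr : IsDyadic r) : IsDyadic (r / 2) := by
  obtain ⟨m, n, rfl⟩ := hr
  exact ⟨m, n + 1, by rw [pow_succ]; field_simp⟩

theorem isDyadic_int (m : ℤ) : IsDyadic m := ⟨m, 0, by simp⟩

theorem isDyadic_half_iff {r : ℝ} : IsDyadic (r / 2) ↔ IsDyadic r :=
  ⟨fun h => by simpa using h.add h, fun h => h.half⟩

theorem isDyadic_add_iff {r s : ℝ} (hs : IsDyadic s) : IsDyadic (r + s) ↔ IsDyadic r :=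
  ⟨fun h => by simpa using h.add hs.neg, fun h => h.add hs⟩

/-- A point of the circle `ℝ / ℤ` is dyadic if it is the image of a dyadic rational. -/
def IsDyadicPt (x : UnitAddCircle) : Prop := ∃ r : ℝ, IsDyadic r ∧ (r : UnitAddCircle) = x

theorem isDyadicPt_coe {r : ℝ} : IsDyadicPt (r : UnitAddCircle) ↔ IsDyadic r := by
  refine ⟨?_, fun h => ⟨r, h, rfl⟩⟩
  rintro ⟨s, hs, h⟩
  have h0 : ((r - s : ℝ) : UnitAddCircle) = 0 := by rw [AddCircle.coe_sub, h, sub_self]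
  obtain ⟨n, hn⟩ := (AddCircle.coe_eq_zero_iff (1 : ℝ)).1 h0
  have : r = s + n := by simp at hn; linarith
  rw [this]
  exact hs.add (isDyadic_int n)

/-! ### Thompson's group `F` -/

/-- A homeomorphism `f` of `[0, 1]` is dyadic piecewise linear: away from a finite set of dyadic
points it is locally affine with slopes that are powers of two, and it maps the dyadic rationals
in `[0, 1]` onto themselves. -/
structure IsDyadicPL (f : I ≃ₜ I) : Prop where
  dyadic_iff : ∀ x : I, IsDyadic (f x : ℝ) ↔ IsDyadic (x : ℝ)
  locally_affine : ∃ B : Set I, B.Finite ∧ (∀ b ∈ B, IsDyadic (b : ℝ)) ∧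
    ∀ x ∉ B, ∃ k : ℤ, ∀ᶠ y in 𝓝 x, (f y : ℝ) = f x + (2 : ℝ) ^ k * ((y : ℝ) - x)

theorem IsDyadicPL.one : IsDyadicPL 1 where
  dyadic_iff _ := Iff.rfl
  locally_affine := ⟨∅, Set.finite_empty, by simp, fun x _ => ⟨0, by simp⟩⟩

theorem IsDyadicPL.mul {f g : I ≃ₜ I} (hf : IsDyadicPL f) (hg : IsDyadicPL g) :
    IsDyadicPL (f * g) where
  dyadic_iff x := (hf.dyadic_iff (g x)).trans (hg.dyadic_iff x)
  locally_affine := by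
    obtain ⟨B, hB, hBd, hBf⟩ := hf.locally_affine
    obtain ⟨C, hC, hCd, hCg⟩ := hg.locally_affine
    refine ⟨g ⁻¹' B ∪ C, (hB.preimage g.injective.injOn).union hC, ?_, ?_⟩
    · rintro b (hb | hb)
      · exact (hg.dyadic_iff b).1 (hBd _ hb)
      · exact hCd b hb
    · intro x hx
      simp only [Set.mem_union, Set.mem_preimage, not_or] at hx
      obtain ⟨k, hk⟩ := hBf _ hx.1
      obtain ⟨l, hl⟩ := hCg _ hx.2
      refine ⟨k + l, ?_⟩
      filter_upwards [hl, (g.continuous.tendsto x).eventually hk] with y h1 h2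
      simp only [Homeomorph.mul_apply]
      rw [h2, h1, zpow_add₀ two_ne_zero]
      ring

theorem IsDyadicPL.inv {f : I ≃ₜ I} (hf : IsDyadicPL f) : IsDyadicPL f⁻¹ where
  dyadic_iff x := by simpa using (hf.dyadic_iff (f⁻¹ x)).symm
  locally_affine := by
    obtain ⟨B, hB, hBd, hBf⟩ := hf.locally_affine
    refine ⟨f '' B, hB.image f, ?_, ?_⟩
    · rintro _ ⟨b, hb, rfl⟩
      exact (hf.dyadic_iff b).2 (hBd b hb)
    · intro x hx
      have hy : f⁻¹ x ∉ B := fun h => hx ⟨_, h, by simp⟩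
      obtain ⟨k, hk⟩ := hBf _ hy
      refine ⟨-k, ?_⟩
      filter_upwards [((f⁻¹).continuous.tendsto x).eventually hk] with z hz
      simp only [Homeomorph.inv_apply, Homeomorph.apply_symm_apply] at hz ⊢
      rw [hz, zpow_neg]
      have : (2 : ℝ) ^ k ≠ 0 := zpow_ne_zero _ two_ne_zero
      field_simp
      ring

/-- Thompson's group `F`: the orientation-preserving dyadic piecewise linear homeomorphisms of
`[0, 1]`, under composition. -/
def F : Subgroup (I ≃ₜ I) where
  carrier := {f | StrictMono f ∧ IsDyadicPL f}
  one_mem' := ⟨strictMono_id, IsDyadicPL.one⟩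
  mul_mem' hf hg := ⟨hf.1.comp hg.1, hf.2.mul hg.2⟩
  inv_mem' {f} hf := by
    refine ⟨fun a b hab => ?_, hf.2.inv⟩
    rw [← hf.1.lt_iff_lt]
    simpa using hab

/-! ### Thompson's group `T` -/

/-- A homeomorphism `f` of the circle `ℝ / ℤ` is dyadic piecewise linear and
orientation-preserving: away from a finite set of dyadic points it is locally affine with (positive)
slopes that are powers of two, and it maps the dyadic points of the circle onto themselves. -/
structure IsCircleDyadicPL (f : UnitAddCircle ≃ₜ UnitAddCircle) : Prop where
  dyadic_iff : ∀ x, IsDyadicPt (f x) ↔ IsDyadicPt x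
  locally_affine : ∃ B : Set UnitAddCircle, B.Finite ∧ (∀ b ∈ B, IsDyadicPt b) ∧
    ∀ x ∉ B, ∃ k : ℤ, ∀ᶠ t : ℝ in 𝓝 0, f (x + (t : UnitAddCircle)) =
      f x + (((2 : ℝ) ^ k * t : ℝ) : UnitAddCircle)

theorem tendsto_zpow_mul (k : ℤ) :
    Filter.Tendsto (fun t : ℝ => (2 : ℝ) ^ k * t) (𝓝 0) (𝓝 0) := by
  have h : Continuous fun t : ℝ => (2 : ℝ) ^ k * t := by fun_prop
  simpa using h.tendsto 0

theorem IsCircleDyadicPL.one : IsCircleDyadicPL 1 where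
  dyadic_iff _ := Iff.rfl
  locally_affine := ⟨∅, Set.finite_empty, by simp, fun x _ => ⟨0, by simp⟩⟩

theorem IsCircleDyadicPL.mul {f g : UnitAddCircle ≃ₜ UnitAddCircle}
    (hf : IsCircleDyadicPL f) (hg : IsCircleDyadicPL g) : IsCircleDyadicPL (f * g) where
  dyadic_iff x := (hf.dyadic_iff (g x)).trans (hg.dyadic_iff x)
  locally_affine := by
    obtain ⟨B, hB, hBd, hBf⟩ := hf.locally_affine
    obtain ⟨C, hC, hCd, hCg⟩ := hg.locally_affine
    refine ⟨g ⁻¹' B ∪ C, (hB.preimage g.injective.injOn).union hC, ?_, ?_⟩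
    · rintro b (hb | hb)
      · exact (hg.dyadic_iff b).1 (hBd _ hb)
      · exact hCd b hb
    · intro x hx
      simp only [Set.mem_union, Set.mem_preimage, not_or] at hx
      obtain ⟨k, hk⟩ := hBf _ hx.1
      obtain ⟨l, hl⟩ := hCg _ hx.2
      refine ⟨k + l, ?_⟩
      filter_upwards [hl, (tendsto_zpow_mul l).eventually hk] with t h1 h2
      simp only [Homeomorph.mul_apply]
      rw [h1, h2, zpow_add₀ two_ne_zero, mul_assoc]

theorem IsCircleDyadicPL.inv {f : UnitAddCircle ≃ₜ UnitAddCircle} (hf : IsCircleDyadicPL f) :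
    IsCircleDyadicPL f⁻¹ where
  dyadic_iff x := by simpa using (hf.dyadic_iff (f⁻¹ x)).symm
  locally_affine := by
    obtain ⟨B, hB, hBd, hBf⟩ := hf.locally_affine
    refine ⟨f '' B, hB.image f, ?_, ?_⟩
    · rintro _ ⟨b, hb, rfl⟩
      exact (hf.dyadic_iff b).2 (hBd b hb)
    · intro x hx
      have hy : f⁻¹ x ∉ B := fun h => hx ⟨_, h, by simp⟩
      obtain ⟨k, hk⟩ := hBf _ hy
      refine ⟨-k, ?_⟩
      filter_upwards [(tendsto_zpow_mul (-k)).eventually hk] with t ht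
      apply f.injective
      rw [ht, ← mul_assoc, ← zpow_add₀ two_ne_zero]
      simp

/-- Thompson's group `T`: the orientation-preserving dyadic piecewise linear homeomorphisms of the
circle `ℝ / ℤ`, under composition. -/
def T : Subgroup (UnitAddCircle ≃ₜ UnitAddCircle) where
  carrier := {f | IsCircleDyadicPL f}
  one_mem' := IsCircleDyadicPL.one
  mul_mem' hf hg := hf.mul hg
  inv_mem' hf := hf.inv

/-! ### The inclusion of `F` in `T` -/

/-- The quotient map `[0, 1] → ℝ / ℤ` that identifies the two endpoints. -/
def toCircle (s : I) : UnitAddCircle := ((s : ℝ) : UnitAddCircle)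

theorem toCircle_surjective : Function.Surjective toCircle := by
  intro x
  have hx : x ∈ ((↑) : ℝ → UnitAddCircle) '' Set.Icc 0 (0 + 1) := by
    rw [AddCircle.coe_image_Icc_eq]
    trivial
  obtain ⟨s, hs, rfl⟩ := hx
  exact ⟨⟨s, by simpa using hs⟩, rfl⟩

theorem toCircle_one : toCircle 1 = toCircle 0 := by
  simp [toCircle]

theorem F.map_zero (f : F) : (f : I ≃ₜ I) 0 = 0 := by
  obtain ⟨x, hx⟩ := (f : I ≃ₜ I).surjective 0
  have := f.2.1.monotone (show (0 : I) ≤ x from bot_le)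
  rw [hx] at this
  exact le_antisymm this bot_le

theorem F.map_one (f : F) : (f : I ≃ₜ I) 1 = 1 := by
  obtain ⟨x, hx⟩ := (f : I ≃ₜ I).surjective 1
  have := f.2.1.monotone (show x ≤ (1 : I) from le_top)
  rw [hx] at this
  exact le_antisymm le_top this

/-- The self-map of the circle obtained from an element of `F` by identifying the endpoints of
`[0, 1]`. -/
noncomputable def glueFun (f : F) : UnitAddCircle → UnitAddCircle :=
  AddCircle.liftIco 1 0 fun t => toCircle ((f : I ≃ₜ I) (Set.projIcc 0 1 zero_le_one t))

theorem glueFun_toCircle (f : F) (s : I) :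
    glueFun f (toCircle s) = toCircle ((f : I ≃ₜ I) s) := by
  have key : ∀ s : I, (s : ℝ) < 1 → glueFun f (toCircle s) = toCircle ((f : I ≃ₜ I) s) := by
    intro s hs
    rw [toCircle, glueFun, AddCircle.liftIco_zero_coe_apply ⟨s.2.1, hs⟩, Set.projIcc_val]
  rcases s.2.2.lt_or_eq with h | h
  · exact key s h
  · have : s = 1 := Subtype.ext h
    rw [this, toCircle_one, key 0 (by simp), F.map_zero, F.map_one, toCircle_one]

theorem continuous_glueFun (f : F) : Continuous (glueFun f) := by
  refine AddCircle.liftIco_zero_continuous ?_ ?_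
  · rw [Set.projIcc_left, Set.projIcc_right]
    have h0 := F.map_zero f
    have h1 := F.map_one f
    change toCircle ((f : I ≃ₜ I) 0) = toCircle ((f : I ≃ₜ I) 1)
    rw [h0, h1, toCircle_one]
  · have h : Continuous toCircle := (AddCircle.continuous_mk' 1).comp continuous_subtype_val
    exact (h.comp ((f : I ≃ₜ I).continuous.comp continuous_projIcc)).continuousOn

/-- The homeomorphism of the circle obtained from an element of `F` by identifying the endpoints
of `[0, 1]`. -/
noncomputable def glue (f : F) : UnitAddCircle ≃ₜ UnitAddCircle where
  toFun := glueFun f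
  invFun := glueFun f⁻¹
  left_inv x := by
    obtain ⟨s, rfl⟩ := toCircle_surjective x
    simp [glueFun_toCircle]
  right_inv x := by
    obtain ⟨s, rfl⟩ := toCircle_surjective x
    simp [glueFun_toCircle]
  continuous_toFun := continuous_glueFun f
  continuous_invFun := continuous_glueFun f⁻¹

theorem glue_toCircle (f : F) (s : I) : glue f (toCircle s) = toCircle ((f : I ≃ₜ I) s) :=
  glueFun_toCircle f s

theorem glue_mem_T (f : F) : glue f ∈ T where
  dyadic_iff x := by
    obtain ⟨s, rfl⟩ := toCircle_surjective x
    rw [glue_toCircle]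
    exact isDyadicPt_coe.trans ((f.2.2.dyadic_iff s).trans isDyadicPt_coe.symm)
  locally_affine := by
    obtain ⟨B, hB, hBd, hBf⟩ := f.2.2.locally_affine
    refine ⟨toCircle '' (insert 0 B), (hB.insert 0).image _, ?_, ?_⟩
    · rintro _ ⟨b, rfl | hb, rfl⟩
      · exact isDyadicPt_coe.2 (by simpa using isDyadic_int 0)
      · exact isDyadicPt_coe.2 (hBd b hb)
    · intro x hx
      obtain ⟨s, rfl⟩ := toCircle_surjective x
      have hs : s ∉ insert 0 B := fun h => hx ⟨s, h, rfl⟩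
      have hs0 : s ≠ 0 := fun h => hs (h ▸ Set.mem_insert _ _)
      have hs1 : s ≠ 1 := by
        rintro rfl
        exact hx ⟨0, Set.mem_insert _ _, toCircle_one.symm⟩
      have hpos : (0 : ℝ) < s := lt_of_le_of_ne s.2.1 fun h => hs0 (Subtype.ext h.symm)
      have hlt : (s : ℝ) < 1 := lt_of_le_of_ne s.2.2 fun h => hs1 (Subtype.ext h)
      obtain ⟨k, hk⟩ := hBf s fun h => hs (Set.mem_insert_of_mem _ h)
      refine ⟨k, ?_⟩
      have hc : Filter.Tendsto (fun t : ℝ => Set.projIcc (0 : ℝ) 1 zero_le_one (s + t)) (𝓝 0)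
          (𝓝 s) := by
        have : Continuous (fun t : ℝ => Set.projIcc (0 : ℝ) 1 zero_le_one (s + t)) :=
          continuous_projIcc.comp (by fun_prop)
        simpa using this.tendsto 0
      have hI : ∀ᶠ t : ℝ in 𝓝 0, (s : ℝ) + t ∈ Set.Icc (0 : ℝ) 1 := by
        have : Filter.Tendsto (fun t : ℝ => (s : ℝ) + t) (𝓝 0) (𝓝 s) := by
          have h : Continuous fun t : ℝ => (s : ℝ) + t := by fun_prop
          simpa using h.tendsto 0
        exact this.eventually (Icc_mem_nhds hpos hlt)
      filter_upwards [hc.eventually hk, hI] with t ht hm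
      rw [Set.projIcc_of_mem _ hm] at ht
      have h1 : toCircle s + (t : UnitAddCircle) = toCircle ⟨s + t, hm⟩ := by
        simp [toCircle]
      rw [h1, glue_toCircle, glue_toCircle]
      simp only [toCircle]
      rw [ht, ← AddCircle.coe_add]
      simp

/-- The inclusion of `F` in `T`. -/
noncomputable def inclusion : F →* T where
  toFun f := ⟨glue f, glue_mem_T f⟩
  map_one' := by
    apply Subtype.ext
    ext x
    obtain ⟨s, rfl⟩ := toCircle_surjective x
    exact glue_toCircle 1 s
  map_mul' f g := by
    apply Subtype.ext
    ext x
    obtain ⟨s, rfl⟩ := toCircle_surjective x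
    change glue (f * g) (toCircle s) = glue f (glue g (toCircle s))
    rw [glue_toCircle, glue_toCircle, glue_toCircle]
    rfl

/-! ### The generators -/

/-- A strictly increasing map of `[0, 1]` with a right inverse, as a homeomorphism. -/
noncomputable def homeoOfStrictMono (f g : I → I) (hf : StrictMono f) (hg : Function.RightInverse g f) :
    I ≃ₜ I :=
  (hf.orderIsoOfRightInverse f g hg).toHomeomorph

/-- The formula of the generator `x₀` of `F`. -/
noncomputable def x₀Fun (t : ℝ) : ℝ :=
  if t ≤ 1 / 2 then t / 2 else if t ≤ 3 / 4 then t - 1 / 4 else 2 * t - 1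

/-- The formula of the inverse of `x₀`. -/
noncomputable def x₀InvFun (t : ℝ) : ℝ :=
  if t ≤ 1 / 4 then 2 * t else if t ≤ 1 / 2 then t + 1 / 4 else (t + 1) / 2

/-- The formula of the generator `x₁` of `F`. -/
noncomputable def x₁Fun (t : ℝ) : ℝ :=
  if t ≤ 1 / 2 then t else if t ≤ 3 / 4 then t / 2 + 1 / 4 else
    if t ≤ 7 / 8 then t - 1 / 8 else 2 * t - 1

/-- The formula of the inverse of `x₁`. -/
noncomputable def x₁InvFun (t : ℝ) : ℝ :=
  if t ≤ 1 / 2 then t else if t ≤ 5 / 8 then 2 * t - 1 / 2 else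
    if t ≤ 3 / 4 then t + 1 / 8 else (t + 1) / 2

/-- The homeomorphism `x₀` of `[0, 1]`: it maps `[0, 1/2]`, `[1/2, 3/4]`, `[3/4, 1]` affinely onto
`[0, 1/4]`, `[1/4, 1/2]`, `[1/2, 1]`. -/
noncomputable def x₀Homeo : I ≃ₜ I :=
  homeoOfStrictMono
    (fun s => ⟨x₀Fun s, by
      obtain ⟨h0, h1⟩ := s.2
      unfold x₀Fun
      split_ifs <;> constructor <;> linarith⟩)
    (fun s => ⟨x₀InvFun s, by
      obtain ⟨h0, h1⟩ := s.2
      unfold x₀InvFun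
      split_ifs <;> constructor <;> linarith⟩)
    (by
      intro s t h
      have h' : (s : ℝ) < t := h
      change x₀Fun s < x₀Fun t
      unfold x₀Fun
      split_ifs <;> linarith)
    (by
      intro s
      apply Subtype.ext
      change x₀Fun (x₀InvFun s) = s
      unfold x₀Fun x₀InvFun
      split_ifs <;> linarith)

/-- The homeomorphism `x₁` of `[0, 1]`: it is the identity on `[0, 1/2]` and maps `[1/2, 3/4]`,
`[3/4, 7/8]`, `[7/8, 1]` affinely onto `[1/2, 5/8]`, `[5/8, 3/4]`, `[3/4, 1]`. -/
noncomputable def x₁Homeo : I ≃ₜ I :=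
  homeoOfStrictMono
    (fun s => ⟨x₁Fun s, by
      obtain ⟨h0, h1⟩ := s.2
      unfold x₁Fun
      split_ifs <;> constructor <;> linarith⟩)
    (fun s => ⟨x₁InvFun s, by
      obtain ⟨h0, h1⟩ := s.2
      unfold x₁InvFun
      split_ifs <;> constructor <;> linarith⟩)
    (by
      intro s t h
      have h' : (s : ℝ) < t := h
      change x₁Fun s < x₁Fun t
      unfold x₁Fun
      split_ifs <;> linarith)
    (by
      intro s
      apply Subtype.ext
      change x₁Fun (x₁InvFun s) = s
      unfold x₁Fun x₁InvFun
      split_ifs <;> linarith)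

theorem x₀Homeo_apply (s : I) : (x₀Homeo s : ℝ) = x₀Fun s := rfl

theorem x₁Homeo_apply (s : I) : (x₁Homeo s : ℝ) = x₁Fun s := rfl

theorem strictMono_x₀Homeo : StrictMono x₀Homeo := OrderIso.strictMono _

theorem strictMono_x₁Homeo : StrictMono x₁Homeo := OrderIso.strictMono _

theorem eventually_lt_coe {s : I} {a : ℝ} (h : a < s) : ∀ᶠ y : I in 𝓝 s, a < (y : ℝ) :=
  (continuous_subtype_val.tendsto s).eventually (lt_mem_nhds h)

theorem eventually_coe_lt {s : I} {a : ℝ} (h : (s : ℝ) < a) : ∀ᶠ y : I in 𝓝 s, (y : ℝ) < a :=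
  (continuous_subtype_val.tendsto s).eventually (gt_mem_nhds h)

theorem isDyadic_div (m : ℤ) (n : ℕ) : IsDyadic (m / 2 ^ n) := ⟨m, n, rfl⟩

theorem isDyadic_two_mul_iff {r : ℝ} : IsDyadic (2 * r) ↔ IsDyadic r := by
  rw [← isDyadic_half_iff, mul_div_cancel_left₀ r two_ne_zero]

theorem x₀Homeo_mem_F : x₀Homeo ∈ F := by
  have d1 : IsDyadic (1 / 2) := by simpa using isDyadic_div 1 1
  have d2 : IsDyadic (3 / 4) := by convert isDyadic_div 3 2 using 1; norm_num
  have d3 : IsDyadic (1 / 4) := by convert isDyadic_div 1 2 using 1; norm_num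
  have d4 : IsDyadic 1 := by simpa using isDyadic_int 1
  refine ⟨strictMono_x₀Homeo, ?_, ?_⟩
  · intro x
    rw [x₀Homeo_apply, x₀Fun]
    split_ifs
    · exact isDyadic_half_iff
    · rw [sub_eq_add_neg, isDyadic_add_iff d3.neg]
    · rw [sub_eq_add_neg, isDyadic_add_iff d4.neg, isDyadic_two_mul_iff]
  · refine ⟨((↑) : I → ℝ) ⁻¹' {1 / 2, 3 / 4},
      (Set.toFinite _).preimage Subtype.val_injective.injOn, ?_, ?_⟩
    · rintro b (hb | hb) <;> rw [hb] <;> assumption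
    · intro x hx
      simp only [Set.mem_preimage, Set.mem_insert_iff, Set.mem_singleton_iff, not_or] at hx
      simp only [x₀Homeo_apply, x₀Fun]
      rcases lt_or_gt_of_ne hx.1 with h | h
      · refine ⟨-1, ?_⟩
        filter_upwards [eventually_coe_lt h] with y hy
        rw [if_pos hy.le, if_pos h.le, zpow_neg_one]
        ring
      rcases lt_or_gt_of_ne hx.2 with h' | h'
      · refine ⟨0, ?_⟩
        filter_upwards [eventually_coe_lt h', eventually_lt_coe h] with y hy hy'
        rw [if_neg hy'.not_ge, if_pos hy.le, if_neg h.not_ge, if_pos h'.le, zpow_zero]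
        ring
      · refine ⟨1, ?_⟩
        filter_upwards [eventually_lt_coe h', eventually_lt_coe h] with y hy hy'
        rw [if_neg hy'.not_ge, if_neg hy.not_ge, if_neg h.not_ge, if_neg h'.not_ge, zpow_one]
        ring

theorem x₁Homeo_mem_F : x₁Homeo ∈ F := by
  have d1 : IsDyadic (1 / 2) := by simpa using isDyadic_div 1 1
  have d2 : IsDyadic (3 / 4) := by convert isDyadic_div 3 2 using 1; norm_num
  have d3 : IsDyadic (1 / 4) := by convert isDyadic_div 1 2 using 1; norm_num
  have d4 : IsDyadic 1 := by simpa using isDyadic_int 1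
  have d5 : IsDyadic (7 / 8) := by convert isDyadic_div 7 3 using 1; norm_num
  have d6 : IsDyadic (1 / 8) := by convert isDyadic_div 1 3 using 1; norm_num
  refine ⟨strictMono_x₁Homeo, ?_, ?_⟩
  · intro x
    rw [x₁Homeo_apply, x₁Fun]
    split_ifs
    · exact Iff.rfl
    · rw [isDyadic_add_iff d3, isDyadic_half_iff]
    · rw [sub_eq_add_neg, isDyadic_add_iff d6.neg]
    · rw [sub_eq_add_neg, isDyadic_add_iff d4.neg, isDyadic_two_mul_iff]
  · refine ⟨((↑) : I → ℝ) ⁻¹' {1 / 2, 3 / 4, 7 / 8},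
      (Set.toFinite _).preimage Subtype.val_injective.injOn, ?_, ?_⟩
    · rintro b (hb | hb | hb) <;> rw [hb] <;> assumption
    · intro x hx
      simp only [Set.mem_preimage, Set.mem_insert_iff, Set.mem_singleton_iff, not_or] at hx
      simp only [x₁Homeo_apply, x₁Fun]
      rcases lt_or_gt_of_ne hx.1 with h | h
      · refine ⟨0, ?_⟩
        filter_upwards [eventually_coe_lt h] with y hy
        rw [if_pos hy.le, if_pos h.le, zpow_zero]
        ring
      rcases lt_or_gt_of_ne hx.2.1 with h' | h'
      · refine ⟨-1, ?_⟩
        filter_upwards [eventually_coe_lt h', eventually_lt_coe h] with y hy hy'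
        rw [if_neg hy'.not_ge, if_pos hy.le, if_neg h.not_ge, if_pos h'.le, zpow_neg_one]
        ring
      rcases lt_or_gt_of_ne hx.2.2 with h'' | h''
      · refine ⟨0, ?_⟩
        filter_upwards [eventually_lt_coe h', eventually_lt_coe h, eventually_coe_lt h'']
          with y hy hy' hy''
        rw [if_neg hy'.not_ge, if_neg hy.not_ge, if_neg h.not_ge, if_neg h'.not_ge,
          if_pos hy''.le, if_pos h''.le, zpow_zero]
        ring
      · refine ⟨1, ?_⟩
        filter_upwards [eventually_lt_coe h', eventually_lt_coe h, eventually_lt_coe h'']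
          with y hy hy' hy''
        rw [if_neg hy'.not_ge, if_neg hy.not_ge, if_neg h.not_ge, if_neg h'.not_ge,
          if_neg hy''.not_ge, if_neg h''.not_ge, zpow_one]
        ring

/-- The generator `x₀` of `F`. -/
noncomputable def x₀ : F := ⟨x₀Homeo, x₀Homeo_mem_F⟩

/-- The generator `x₁` of `F`. -/
noncomputable def x₁ : F := ⟨x₁Homeo, x₁Homeo_mem_F⟩

/-- The rotation of the circle by one half; it exchanges the images of `[0, 1/2]` and
`[1/2, 1]`. -/
noncomputable def c₀Homeo : UnitAddCircle ≃ₜ UnitAddCircle :=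
  Homeomorph.addRight (((1 / 2 : ℝ)) : UnitAddCircle)

theorem c₀Homeo_mem_T : c₀Homeo ∈ T where
  dyadic_iff x := by
    obtain ⟨s, rfl⟩ := toCircle_surjective x
    have d1 : IsDyadic (1 / 2) := by simpa using isDyadic_div 1 1
    change IsDyadicPt (((s : ℝ) : UnitAddCircle) + ((1 / 2 : ℝ) : UnitAddCircle)) ↔ _
    rw [← AddCircle.coe_add, isDyadicPt_coe, isDyadic_add_iff d1]
    exact isDyadicPt_coe.symm
  locally_affine := ⟨∅, Set.finite_empty, by simp, fun x _ => ⟨0, by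
    refine Filter.Eventually.of_forall fun t => ?_
    change x + (t : UnitAddCircle) + _ = x + _ + _
    rw [zpow_zero, one_mul]
    abel⟩⟩

/-- The generator `c₀` of `T`, an element of order two. -/
noncomputable def c₀ : T := ⟨c₀Homeo, c₀Homeo_mem_T⟩

/-! ### Word length -/

/-- The word length of `g` with respect to `S`: the least length of a product of elements of `S`
and their inverses that is equal to `g` (and `⊤` if there is no such product). -/
noncomputable def wordLength {G : Type*} [Group G] (S : Set G) (g : G) : ℕ∞ :=
  ⨅ (l : List G) (_ : (∀ s ∈ l, s ∈ S ∨ s⁻¹ ∈ S) ∧ l.prod = g), (l.length : ℕ∞)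

/-! ### Tree pair diagrams -/

/-- The dyadic subdivision of `[a, b]` described by a finite rooted binary tree: the list, from
left to right, of the (endpoints of the) intervals that belong to the leaves. A caret halves the
interval of the node that it hangs from. -/
noncomputable def leafIntervals : BinaryTree Unit → ℝ → ℝ → List (ℝ × ℝ)
  | .nil, a, b => [(a, b)]
  | .node _ l r, a, b => leafIntervals l a ((a + b) / 2) ++ leafIntervals r ((a + b) / 2) b

/-- `HasExposedCaret t i`: the leaves `i` and `i + 1` of `t` (numbered from `0`, left to right) are
the two leaves of one caret of `t`. -/
def HasExposedCaret : BinaryTree Unit → ℕ → Prop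
  | .nil, _ => False
  | .node _ l r, i => (l = .nil ∧ r = .nil ∧ i = 0) ∨ HasExposedCaret l i ∨
      ∃ j, i = l.numLeaves + j ∧ HasExposedCaret r j

/-- A tree pair diagram: two finite rooted binary trees with the same number of leaves. -/
structure TreePair where
  /-- the source tree -/
  source : BinaryTree Unit
  /-- the target tree -/
  target : BinaryTree Unit
  numLeaves_eq : source.numLeaves = target.numLeaves

/-- The number of carets of either tree of a tree pair diagram. -/
def TreePair.carets (D : TreePair) : ℕ := D.source.numNodes

/-- The diagram is reduced: there is no `i` such that the leaves `i` and `i + 1` form an exposed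
caret in both trees. -/
def TreePair.IsReduced (D : TreePair) : Prop :=
  ∀ i, ¬ (HasExposedCaret D.source i ∧ HasExposedCaret D.target i)

/-- The diagram represents `w`: for every `i`, the homeomorphism `w` maps the interval of leaf `i`
of the source tree affinely and increasingly onto the interval of leaf `i` of the target tree. -/
def TreePair.Represents (D : TreePair) (w : F) : Prop :=
  List.Forall₂
    (fun J K : ℝ × ℝ => ∀ s : I, J.1 ≤ s → (s : ℝ) ≤ J.2 →
      ((w : I ≃ₜ I) s : ℝ) = K.1 + (K.2 - K.1) / (J.2 - J.1) * (s - J.1))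
    (leafIntervals D.source 0 1) (leafIntervals D.target 0 1)

/-- `N(w)`: the number of carets of either tree of the reduced tree pair diagram of `w`. (Each
element of `F` has exactly one such diagram, so that the set below is a singleton.) -/
noncomputable def caretNumber (w : F) : ℕ :=
  sInf {n | ∃ D : TreePair, D.IsReduced ∧ D.Represents w ∧ D.carets = n}

end Thompson

namespace Thompson

open BinaryTree

/-! Only the lower bound needs work: a word for `w` in the generators of `T` must not be shorter
than |w|_F. Read the word from right to left and, for the partial product `g`, maintain a target
tree with a root caret whose leaf intervals are images under `g` of standard dyadic intervals
(`Fits`). A generator rearranges a few subtrees once the carets it needs are present. In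
`complexity` a trivial right subtree counts as one extra caret, so that the first split on the right
is paid in advance. With this count each letter costs at most one, and since the identity starts at
2, a word of length n ends with complexity at most n + 2.

A word with a rotation that evaluates into F does better by one (`exists_tree_of_word`). The
rotation exchanges the two subtrees, so it can cost something only if the left subtree is trivial
and the right one is not. If the first rotation is not free, it leaves a nontrivial left subtree and
moves the point 0. Letters of F keep 0 displaced, and one that trivialises the left subtree is
itself free. If the left subtree is still nontrivial at the next rotation, that rotation is free.
Hence either some letter is free, or 0 is still displaced at the end, which is impossible for an
element of F.

By `caretNumber_le_of_fits`, N(w) is at most the number of carets of the final tree. A word with a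
rotation therefore satisfies N(w) ≤ n + 1, and the hypothesis gives |w|_F ≤ n. A word without
rotations is already a word in F. -/

/-- `g` maps the arc `[a, b]` of the circle affinely onto the arc `[a', b']`. -/
def MapsAffinely (g : T) (a b a' b' : ℝ) : Prop :=
  ∀ u ∈ Set.Icc (0 : ℝ) 1, (g : UnitAddCircle ≃ₜ UnitAddCircle)
    ((a + (b - a) * u : ℝ) : UnitAddCircle) = ((a' + (b' - a') * u : ℝ) : UnitAddCircle)

namespace MapsAffinely

variable {g h : T} {a b a' b' a'' b'' : ℝ}

theorem mul (hg : MapsAffinely g a b a' b') (hh : MapsAffinely h a' b' a'' b'') :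
    MapsAffinely (h * g) a b a'' b'' := fun u hu => by
  rw [Subgroup.coe_mul, Homeomorph.mul_apply, hg u hu, hh u hu]

theorem inv (hg : MapsAffinely g a b a' b') : MapsAffinely g⁻¹ a' b' a b := fun u hu => by
  rw [← hg u hu, Subgroup.coe_inv, Homeomorph.inv_apply, Homeomorph.symm_apply_apply]

theorem left_half (hg : MapsAffinely g a b a' b') :
    MapsAffinely g a ((a + b) / 2) a' ((a' + b') / 2) := fun u hu => by
  have := hg (u / 2) ⟨by linarith [hu.1], by linarith [hu.2]⟩
  rwa [show a + (b - a) * (u / 2) = a + ((a + b) / 2 - a) * u by ring,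
    show a' + (b' - a') * (u / 2) = a' + ((a' + b') / 2 - a') * u by ring] at this

theorem right_half (hg : MapsAffinely g a b a' b') :
    MapsAffinely g ((a + b) / 2) b ((a' + b') / 2) b' := fun u hu => by
  have := hg ((1 + u) / 2) ⟨by linarith [hu.1], by linarith [hu.2]⟩
  rwa [show a + (b - a) * ((1 + u) / 2) = (a + b) / 2 + (b - (a + b) / 2) * u by ring,
    show a' + (b' - a') * ((1 + u) / 2) = (a' + b') / 2 + (b' - (a' + b') / 2) * u by ring] at this

end MapsAffinely

/-! ### Target trees adapted to an element of T -/

/-- `[a, b]` is a standard dyadic interval `[m / 2 ^ n, (m + 1) / 2 ^ n]` in `[0, 1]`. -/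
def IsStandard (J : ℝ × ℝ) : Prop :=
  ∃ m n : ℕ, m < 2 ^ n ∧ J.1 = m / 2 ^ n ∧ J.2 = (m + 1) / 2 ^ n

theorem IsStandard.left_half {a b : ℝ} (h : IsStandard (a, b)) : IsStandard (a, (a + b) / 2) := by
  obtain ⟨m, n, hm, h1, h2⟩ := h
  dsimp only at h1 h2
  refine ⟨2 * m, n + 1, by rw [pow_succ]; omega, ?_, ?_⟩
  · dsimp only; rw [h1, pow_succ]; push_cast; field_simp
  · dsimp only; rw [h1, h2, pow_succ]; push_cast; field_simp; ring

theorem IsStandard.right_half {a b : ℝ} (h : IsStandard (a, b)) :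
    IsStandard ((a + b) / 2, b) := by
  obtain ⟨m, n, hm, h1, h2⟩ := h
  dsimp only at h1 h2
  refine ⟨2 * m + 1, n + 1, by rw [pow_succ]; omega, ?_, ?_⟩
  · dsimp only; rw [h1, h2, pow_succ]; push_cast; field_simp; ring
  · dsimp only; rw [h2, pow_succ]; push_cast; field_simp; ring

/-- Every leaf interval of the subdivision of `[a, b]` described by `R` is the affine image under
`g` of a standard dyadic interval. -/
def Fits (g : T) (R : BinaryTree Unit) (a b : ℝ) : Prop :=
  ∀ K ∈ leafIntervals R a b, ∃ J, IsStandard J ∧ MapsAffinely g J.1 J.2 K.1 K.2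

namespace Fits

variable {g h : T} {a b a' b' m : ℝ} {A B : BinaryTree Unit}

theorem nil_iff : Fits g .nil a b ↔ ∃ J, IsStandard J ∧ MapsAffinely g J.1 J.2 a b := by
  simp [Fits, leafIntervals]

theorem node_iff (hm : (a + b) / 2 = m) :
    Fits g (.node () A B) a b ↔ Fits g A a m ∧ Fits g B m b := by
  subst hm
  simp only [Fits, leafIntervals, List.forall_mem_append]

theorem split (hg : Fits g .nil a b) : Fits g (.node () .nil .nil) a b := by
  obtain ⟨⟨p, q⟩, hJ, hM⟩ := nil_iff.1 hg
  exact (node_iff rfl).2 ⟨nil_iff.2 ⟨_, hJ.left_half, hM.left_half⟩,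
    nil_iff.2 ⟨_, hJ.right_half, hM.right_half⟩⟩

/-- A map that is affine on all of `[a, b]` commutes with halving, so it carries the subdivision
along with its shape unchanged. -/
theorem mul (hg : Fits g A a b) (hh : MapsAffinely h a b a' b') : Fits (h * g) A a' b' := by
  induction A generalizing a b a' b' with
  | nil =>
    obtain ⟨J, hJ, hM⟩ := nil_iff.1 hg
    exact nil_iff.2 ⟨J, hJ, hM.mul hh⟩
  | node _ l r hl hr =>
    obtain ⟨h1, h2⟩ := (node_iff rfl).1 hg
    exact (node_iff rfl).2 ⟨hl h1 hh.left_half, hr h2 hh.right_half⟩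

end Fits

/-! ### Counting carets -/

/-- `1` for the tree without carets, `0` for all other trees. -/
def nilDefect : BinaryTree Unit → ℕ
  | .nil => 1
  | .node _ _ _ => 0

@[simp] theorem nilDefect_nil : nilDefect .nil = 1 := rfl

@[simp] theorem nilDefect_node (u : Unit) (A B : BinaryTree Unit) :
    nilDefect (.node u A B) = 0 := rfl

/-- The complexity of the tree with a root caret and the two given subtrees: its number of carets,
plus one if the right subtree is trivial. -/
def complexity (A B : BinaryTree Unit) : ℕ := A.numNodes + B.numNodes + 1 + nilDefect B

/-- A trivial tree may be replaced by a single caret. -/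
theorem Fits.exists_node {g : T} {R : BinaryTree Unit} {a b : ℝ} (hR : Fits g R a b) :
    ∃ B C, Fits g (.node () B C) a b ∧
      B.numNodes + C.numNodes + 1 = R.numNodes + nilDefect R := by
  cases R with
  | nil => exact ⟨.nil, .nil, hR.split, by simp⟩
  | node _ B C => exact ⟨B, C, hR, by simp⟩

theorem nilDefect_le (A : BinaryTree Unit) : nilDefect A ≤ 1 := by
  cases A <;> simp

/-! ### The action of the generators -/

theorem glue_coe (f : F) (s : I) :
    (inclusion f : UnitAddCircle ≃ₜ UnitAddCircle) ((s : ℝ) : UnitAddCircle) =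
      (((f : I ≃ₜ I) s : ℝ) : UnitAddCircle) :=
  glue_toCircle f s

theorem MapsAffinely.inclusion {f : F} {φ : ℝ → ℝ} (hφ : ∀ s : I, ((f : I ≃ₜ I) s : ℝ) = φ s)
    {a b a' b' : ℝ} (ha : 0 ≤ a) (hab : a ≤ b) (hb : b ≤ 1)
    (h : ∀ u ∈ Set.Icc (0 : ℝ) 1, φ (a + (b - a) * u) = a' + (b' - a') * u) :
    MapsAffinely (inclusion f) a b a' b' := fun u hu => by
  have h1 : 0 ≤ (b - a) * u := mul_nonneg (by linarith) hu.1
  have h2 : (b - a) * u ≤ b - a := mul_le_of_le_one_right (by linarith) hu.2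
  have := glue_coe f ⟨a + (b - a) * u, by linarith, by linarith⟩
  rw [this, hφ, h u hu]

theorem x₀_maps₁ : MapsAffinely (inclusion x₀) 0 (1 / 2) 0 (1 / 4) :=
  .inclusion (φ := x₀Fun) (fun _ => rfl) (by norm_num) (by norm_num) (by norm_num)
    fun u ⟨h0, h1⟩ => by unfold x₀Fun; split_ifs <;> linarith

theorem x₀_maps₂ : MapsAffinely (inclusion x₀) (1 / 2) (3 / 4) (1 / 4) (1 / 2) :=
  .inclusion (φ := x₀Fun) (fun _ => rfl) (by norm_num) (by norm_num) (by norm_num)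
    fun u ⟨h0, h1⟩ => by unfold x₀Fun; split_ifs <;> linarith

theorem x₀_maps₃ : MapsAffinely (inclusion x₀) (3 / 4) 1 (1 / 2) 1 :=
  .inclusion (φ := x₀Fun) (fun _ => rfl) (by norm_num) (by norm_num) (by norm_num)
    fun u ⟨h0, h1⟩ => by unfold x₀Fun; split_ifs <;> linarith

theorem x₁_maps₁ : MapsAffinely (inclusion x₁) 0 (1 / 2) 0 (1 / 2) :=
  .inclusion (φ := x₁Fun) (fun _ => rfl) (by norm_num) (by norm_num) (by norm_num)
    fun u ⟨h0, h1⟩ => by unfold x₁Fun; split_ifs <;> linarith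

theorem x₁_maps₂ : MapsAffinely (inclusion x₁) (1 / 2) (3 / 4) (1 / 2) (5 / 8) :=
  .inclusion (φ := x₁Fun) (fun _ => rfl) (by norm_num) (by norm_num) (by norm_num)
    fun u ⟨h0, h1⟩ => by unfold x₁Fun; split_ifs <;> linarith

theorem x₁_maps₃ : MapsAffinely (inclusion x₁) (3 / 4) (7 / 8) (5 / 8) (3 / 4) :=
  .inclusion (φ := x₁Fun) (fun _ => rfl) (by norm_num) (by norm_num) (by norm_num)
    fun u ⟨h0, h1⟩ => by unfold x₁Fun; split_ifs <;> linarith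

theorem x₁_maps₄ : MapsAffinely (inclusion x₁) (7 / 8) 1 (3 / 4) 1 :=
  .inclusion (φ := x₁Fun) (fun _ => rfl) (by norm_num) (by norm_num) (by norm_num)
    fun u ⟨h0, h1⟩ => by unfold x₁Fun; split_ifs <;> linarith

theorem c₀_coe (t : ℝ) :
    (c₀ : UnitAddCircle ≃ₜ UnitAddCircle) (t : UnitAddCircle) = ((t + 1 / 2 : ℝ) : UnitAddCircle) :=
  (AddCircle.coe_add 1 t (1 / 2)).symm

theorem c₀_maps₁ : MapsAffinely c₀ 0 (1 / 2) (1 / 2) 1 := fun u _ => by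
  rw [c₀_coe]; congr 1; ring

theorem c₀_maps₂ : MapsAffinely c₀ (1 / 2) 1 0 (1 / 2) := fun u _ => by
  rw [c₀_coe, ← AddCircle.coe_add_period 1 (0 + _)]; congr 1; ring

theorem c₀_inv : c₀⁻¹ = c₀ := by
  rw [inv_eq_iff_mul_eq_one]
  apply Subtype.ext
  ext x
  obtain ⟨s, rfl⟩ := toCircle_surjective x
  rw [Subgroup.coe_mul, Homeomorph.mul_apply, toCircle, c₀_coe, c₀_coe, add_assoc, add_halves,
    AddCircle.coe_add_period]
  rfl

/-! ### The effect of a generator on a target tree -/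

/-- The effect on the target tree of multiplication on the left by a generator of `F`. -/
def IsTreeStep (h : T) : Prop :=
  ∀ (g : T) (A B : BinaryTree Unit), Fits g (.node () A B) 0 1 →
    ∃ A' B', Fits (h * g) (.node () A' B') 0 1 ∧ complexity A' B' ≤ complexity A B + 1 ∧
      (A ≠ .nil → A' ≠ .nil ∨ complexity A' B' ≤ complexity A B)

/-- The rotation A(BC) ↦ (AB)C at the root. Splitting a trivial right subtree is paid for by its
defect, so the cost is exactly the defect of the new right subtree `C`. -/
theorem isTreeStep_x₀ : IsTreeStep (inclusion x₀) := by
  intro g A R hg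
  obtain ⟨hA, hR⟩ := (Fits.node_iff (m := 1 / 2) (by norm_num)).1 hg
  obtain ⟨B, C, hBC, hn⟩ := hR.exists_node
  obtain ⟨hB, hC⟩ := (Fits.node_iff (m := 3 / 4) (by norm_num)).1 hBC
  refine ⟨.node () A B, C, ?_, ?_, ?_⟩
  · rw [Fits.node_iff (m := 1 / 2) (by norm_num), Fits.node_iff (m := 1 / 4) (by norm_num)]
    exact ⟨⟨hA.mul x₀_maps₁, hB.mul x₀_maps₂⟩, hC.mul x₀_maps₃⟩
  · have := nilDefect_le C
    simp only [complexity, numNodes]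
    omega
  · simp

/-- The rotation (AB)C ↦ A(BC). A caret is added only when `L` is trivial. This is the only letter
that can trivialise a nontrivial left subtree, and it then costs nothing. -/
theorem isTreeStep_x₀_inv : IsTreeStep (inclusion x₀)⁻¹ := by
  intro g L C hg
  obtain ⟨hL, hC⟩ := (Fits.node_iff (m := 1 / 2) (by norm_num)).1 hg
  obtain ⟨A, B, hAB, hn⟩ := hL.exists_node
  obtain ⟨hA, hB⟩ := (Fits.node_iff (m := 1 / 4) (by norm_num)).1 hAB
  refine ⟨A, .node () B C, ?_, ?_, fun hL => Or.inr ?_⟩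
  · rw [Fits.node_iff (m := 1 / 2) (by norm_num), Fits.node_iff (m := 3 / 4) (by norm_num)]
    exact ⟨hA.mul x₀_maps₁.inv, hB.mul x₀_maps₂.inv, hC.mul x₀_maps₃.inv⟩
  · have := nilDefect_le L
    simp only [complexity, numNodes, nilDefect_node]
    omega
  · cases L with
    | nil => exact absurd rfl hL
    | node _ _ _ =>
      simp only [complexity, numNodes, nilDefect_node] at hn ⊢
      omega

/-- The left half is untouched, and the rotation takes place in the right subtree. Of the two splits
the first is covered by the defect of `R`, so only the split of `R'` can cost a caret. -/
theorem isTreeStep_x₁ : IsTreeStep (inclusion x₁) := by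
  intro g A R hg
  obtain ⟨hA, hR⟩ := (Fits.node_iff (m := 1 / 2) (by norm_num)).1 hg
  obtain ⟨B, R', hR', hn⟩ := hR.exists_node
  obtain ⟨hB, hR'⟩ := (Fits.node_iff (m := 3 / 4) (by norm_num)).1 hR'
  obtain ⟨C, D, hCD, hn'⟩ := hR'.exists_node
  obtain ⟨hC, hD⟩ := (Fits.node_iff (m := 7 / 8) (by norm_num)).1 hCD
  refine ⟨A, .node () (.node () B C) D, ?_, ?_, fun h => Or.inl h⟩
  · rw [Fits.node_iff (m := 1 / 2) (by norm_num), Fits.node_iff (m := 3 / 4) (by norm_num),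
      Fits.node_iff (m := 5 / 8) (by norm_num)]
    exact ⟨hA.mul x₁_maps₁, ⟨hB.mul x₁_maps₂, hC.mul x₁_maps₃⟩, hD.mul x₁_maps₄⟩
  · have := nilDefect_le R'
    simp only [complexity, numNodes, nilDefect_node]
    omega

theorem isTreeStep_x₁_inv : IsTreeStep (inclusion x₁)⁻¹ := by
  intro g A R hg
  obtain ⟨hA, hR⟩ := (Fits.node_iff (m := 1 / 2) (by norm_num)).1 hg
  obtain ⟨R', D, hR', hn⟩ := hR.exists_node
  obtain ⟨hR', hD⟩ := (Fits.node_iff (m := 3 / 4) (by norm_num)).1 hR'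
  obtain ⟨B, C, hBC, hn'⟩ := hR'.exists_node
  obtain ⟨hB, hC⟩ := (Fits.node_iff (m := 5 / 8) (by norm_num)).1 hBC
  refine ⟨A, .node () B (.node () C D), ?_, ?_, fun h => Or.inl h⟩
  · rw [Fits.node_iff (m := 1 / 2) (by norm_num), Fits.node_iff (m := 3 / 4) (by norm_num),
      Fits.node_iff (m := 7 / 8) (by norm_num)]
    exact ⟨hA.mul x₁_maps₁.inv, hB.mul x₁_maps₂.inv, hC.mul x₁_maps₃.inv, hD.mul x₁_maps₄.inv⟩
  · have := nilDefect_le R'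
    simp only [complexity, numNodes, nilDefect_node]
    omega

/-- `f` is one of `x₀`, `x₁` or an inverse of one of them. -/
def IsLetter (f : F) : Prop := f ∈ ({x₀, x₁} : Set F) ∨ f⁻¹ ∈ ({x₀, x₁} : Set F)

theorem IsLetter.isTreeStep {f : F} (hf : IsLetter f) : IsTreeStep (inclusion f) := by
  rcases hf with (rfl | rfl) | (hf | hf)
  · exact isTreeStep_x₀
  · exact isTreeStep_x₁
  · rw [inv_eq_iff_eq_inv.1 hf, map_inv]; exact isTreeStep_x₀_inv
  · rw [inv_eq_iff_eq_inv.1 hf, map_inv]; exact isTreeStep_x₁_inv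

theorem fits_c₀_mul {g : T} {A B : BinaryTree Unit} (hg : Fits g (.node () A B) 0 1) :
    Fits (c₀ * g) (.node () B A) 0 1 := by
  obtain ⟨hA, hB⟩ := (Fits.node_iff (m := 1 / 2) (by norm_num)).1 hg
  rw [Fits.node_iff (m := 1 / 2) (by norm_num)]
  exact ⟨hB.mul c₀_maps₂, hA.mul c₀_maps₁⟩

/-! ### The orbit of the point 0 and the induction along a word -/

theorem inclusion_zero (f : F) :
    (inclusion f : UnitAddCircle ≃ₜ UnitAddCircle) 0 = 0 := by
  have := glue_coe f 0
  rw [F.map_zero] at this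
  simpa using this

theorem inclusion_mul_zero (f : F) (g : T) :
    ((inclusion f * g : T) : UnitAddCircle ≃ₜ UnitAddCircle) 0 = 0 ↔
      (g : UnitAddCircle ≃ₜ UnitAddCircle) 0 = 0 := by
  rw [Subgroup.coe_mul, Homeomorph.mul_apply]
  conv_lhs => rhs; rw [← inclusion_zero f]
  exact (inclusion f : UnitAddCircle ≃ₜ UnitAddCircle).injective.eq_iff

theorem c₀_zero : (c₀ : UnitAddCircle ≃ₜ UnitAddCircle) 0 ≠ 0 := by
  intro h
  have := c₀_coe 0
  rw [AddCircle.coe_zero, h, eq_comm, AddCircle.coe_eq_zero_iff_of_mem_Ico (by norm_num)] at this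
  norm_num at this

theorem inclusion_injective : Function.Injective inclusion := by
  rw [injective_iff_map_eq_one]
  intro f hf
  apply Subtype.ext
  ext s
  change ((f : I ≃ₜ I) s : ℝ) = s
  have h := glue_coe f s
  rw [hf] at h
  -- The circle determines points of `[0, 1)` only; the endpoint 1 is identified with 0 and is
  -- treated by `F.map_one`.
  rcases s.2.2.lt_or_eq with hs | hs
  · have hfs : (f : I ≃ₜ I) s < 1 := by
      rw [← F.map_one f]
      exact f.2.1 hs
    exact ((AddCircle.coe_eq_coe_iff_of_mem_Ico (p := 1) (a := 0)
      ⟨s.2.1, by simpa using hs⟩ ⟨((f : I ≃ₜ I) s).2.1, by simpa using hfs⟩).1 h).symm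
  · obtain rfl : s = 1 := Subtype.ext hs
    rw [F.map_one]

/-- A word in the generators of `T` either is a word in the generators of `F`, or moves `0`, or
satisfies an improved bound on the number of carets. -/
theorem exists_tree_of_word (l : List T)
    (hl : ∀ s ∈ l, s ∈ ({inclusion x₀, inclusion x₁, c₀} : Set T) ∨
      s⁻¹ ∈ ({inclusion x₀, inclusion x₁, c₀} : Set T)) :
    ∃ A B, Fits l.prod (.node () A B) 0 1 ∧ complexity A B ≤ l.length + 2 ∧
      ((∃ l' : List F, (∀ f ∈ l', IsLetter f) ∧ l'.map inclusion = l) ∨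
        ((l.prod : UnitAddCircle ≃ₜ UnitAddCircle) 0 ≠ 0 ∧ A ≠ .nil) ∨
        complexity A B ≤ l.length + 1) := by
  induction l with
  | nil =>
    -- The identity starts with one caret and a trivial right subtree, hence complexity 2.
    refine ⟨.nil, .nil, Fits.split (Fits.nil_iff.2 ⟨(0, 1), ⟨0, 0, by simp⟩, fun u _ => rfl⟩),
      by simp [complexity], Or.inl ⟨[], by simp⟩⟩
  | cons s l ih =>
    obtain ⟨A, B, hAB, hc, ih⟩ := ih fun t ht => hl t (List.mem_cons_of_mem _ ht)
    have hs : (∃ f, IsLetter f ∧ inclusion f = s) ∨ s = c₀ := by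
      rcases hl s List.mem_cons_self with (h | h | h) | (h | h | h)
      · exact Or.inl ⟨x₀, by simp [IsLetter], h.symm⟩
      · exact Or.inl ⟨x₁, by simp [IsLetter], h.symm⟩
      · exact Or.inr h
      · exact Or.inl ⟨x₀⁻¹, by simp [IsLetter], by rw [map_inv, ← h, inv_inv]⟩
      · exact Or.inl ⟨x₁⁻¹, by simp [IsLetter], by rw [map_inv, ← h, inv_inv]⟩
      · exact Or.inr (by rw [← inv_inv s, h, c₀_inv])
    rw [List.prod_cons, List.length_cons]
    rcases hs with ⟨f, hf, rfl⟩ | rfl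
    · obtain ⟨A', B', hAB', hc', hA'⟩ := hf.isTreeStep _ A B hAB
      refine ⟨A', B', hAB', by omega, ?_⟩
      rcases ih with ⟨l', hl', rfl⟩ | ⟨h0, hA⟩ | ih
      · exact Or.inl ⟨f :: l', List.forall_mem_cons.2 ⟨hf, hl'⟩, by simp⟩
      · rcases hA' hA with hA' | hA'
        · exact Or.inr (Or.inl ⟨fun h => h0 ((inclusion_mul_zero f _).1 h), hA'⟩)
        · exact Or.inr (Or.inr (by omega))
      · exact Or.inr (Or.inr (by omega))
    · refine ⟨B, A, fits_c₀_mul hAB, ?_⟩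
      -- A rotation keeps the carets and changes only which subtree has its defect counted.
      have key : complexity B A + nilDefect B = complexity A B + nilDefect A := by
        simp only [complexity]; omega
      have hA1 := nilDefect_le A
      refine ⟨by omega, ?_⟩
      rcases ih with ⟨l', hl', rfl⟩ | ⟨h0, hA⟩ | ih
      -- First rotation: if `B` is trivial, its defect offsets that of `A` and the letter is free;
      -- otherwise `B` becomes a nontrivial left subtree and 0 is moved to 1/2.
      · cases B with
        | nil => exact Or.inr (Or.inr (by simp only [nilDefect_nil] at key; omega))
        | node _ _ _ =>
          refine Or.inr (Or.inl ⟨?_, by simp⟩)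
          rw [← map_list_prod, Subgroup.coe_mul, Homeomorph.mul_apply, inclusion_zero]
          exact c₀_zero
      -- A further rotation with a nontrivial left subtree: `A` has no defect, so the letter is
      -- free.
      · cases A with
        | nil => exact absurd rfl hA
        | node _ _ _ => exact Or.inr (Or.inr (by simp only [nilDefect_node] at key; omega))
      · exact Or.inr (Or.inr (by omega))

/-! ### Leaf lists -/

theorem forall₂_append_iff {α β : Type*} {R : α → β → Prop} {l₁ m₁ : List α} {l₂ m₂ : List β}
    (h : l₁.length = l₂.length) :
    List.Forall₂ R (l₁ ++ m₁) (l₂ ++ m₂) ↔ List.Forall₂ R l₁ l₂ ∧ List.Forall₂ R m₁ m₂ := by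
  induction l₁ generalizing l₂ with
  | nil =>
    cases l₂ with
    | nil => simp
    | cons _ _ => simp at h
  | cons a l₁ ih =>
    cases l₂ with
    | nil => simp at h
    | cons b l₂ => simp [ih (by simpa using h), and_assoc]

theorem length_leafIntervals (t : BinaryTree Unit) (a b : ℝ) :
    (leafIntervals t a b).length = t.numLeaves := by
  induction t generalizing a b with
  | nil => rfl
  | node _ l r hl hr => simp [leafIntervals, hl, hr]

/-! ### Reduction of tree pair diagrams -/

/-- Removing an exposed caret merges two neighbouring leaf intervals. -/
theorem HasExposedCaret.exists_remove {t : BinaryTree Unit} {i : ℕ} (h : HasExposedCaret t i) :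
    ∃ t' : BinaryTree Unit, t.numNodes = t'.numNodes + 1 ∧ ∀ a b : ℝ, a < b →
      ∃ (l₁ l₂ : List (ℝ × ℝ)) (p q : ℝ), p < q ∧ l₁.length = i ∧
        leafIntervals t a b = l₁ ++ (p, (p + q) / 2) :: ((p + q) / 2, q) :: l₂ ∧
        leafIntervals t' a b = l₁ ++ (p, q) :: l₂ := by
  induction t generalizing i with
  | nil => exact h.elim
  | node _ l r hl hr =>
    rcases h with ⟨rfl, rfl, rfl⟩ | h | ⟨j, rfl, h⟩
    · exact ⟨.nil, rfl, fun a b hab => ⟨[], [], a, b, hab, rfl, rfl, rfl⟩⟩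
    · obtain ⟨t', hn, ht⟩ := hl h
      refine ⟨.node () t' r, by simp [hn]; omega, fun a b hab => ?_⟩
      obtain ⟨l₁, l₂, p, q, hpq, hi, h1, h2⟩ := ht a ((a + b) / 2) (by linarith)
      exact ⟨l₁, l₂ ++ leafIntervals r ((a + b) / 2) b, p, q, hpq, hi,
        by simp [leafIntervals, h1], by simp [leafIntervals, h2]⟩
    · obtain ⟨t', hn, ht⟩ := hr h
      refine ⟨.node () l t', by simp [hn]; omega, fun a b hab => ?_⟩
      obtain ⟨l₁, l₂, p, q, hpq, hi, h1, h2⟩ := ht ((a + b) / 2) b (by linarith)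
      exact ⟨leafIntervals l a ((a + b) / 2) ++ l₁, l₂, p, q, hpq,
        by simp [hi, length_leafIntervals], by simp [leafIntervals, h1], by simp [leafIntervals, h2]⟩

/-- Cancelling a common exposed caret lowers the number of carets, so the process ends. The index
`i` is the same in both trees, which keeps the leaf lists aligned. -/
theorem TreePair.exists_reduced (D : TreePair) (w : F) (hD : D.Represents w) :
    ∃ D' : TreePair, D'.IsReduced ∧ D'.Represents w ∧ D'.carets ≤ D.carets := by
  induction h : D.carets using Nat.strong_induction_on generalizing D with
  | _ n ih =>
    by_cases hr : D.IsReduced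
    · exact ⟨D, hr, hD, h.le⟩
    simp only [IsReduced, not_forall, not_not] at hr
    obtain ⟨i, hs, ht⟩ := hr
    obtain ⟨S, hS, hS'⟩ := hs.exists_remove
    obtain ⟨R, hR, hR'⟩ := ht.exists_remove
    obtain ⟨l₁, l₂, p, q, hpq, hi, h1, h2⟩ := hS' 0 1 one_pos
    obtain ⟨k₁, k₂, p', q', hpq', hi', h1', h2'⟩ := hR' 0 1 one_pos
    have hnum := D.numLeaves_eq
    rw [numLeaves_eq_numNodes_succ, numLeaves_eq_numNodes_succ, hS, hR] at hnum
    have hlt : S.numNodes < n := by rw [← h, TreePair.carets, hS]; omega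
    have hSR : S.numLeaves = R.numLeaves := by
      rw [numLeaves_eq_numNodes_succ, numLeaves_eq_numNodes_succ]; omega
    obtain ⟨D', hD', hw, hc⟩ := ih _ hlt (TreePair.mk S R hSR) (by
        unfold Represents at hD ⊢
        rw [h1, h1', forall₂_append_iff (hi.trans hi'.symm), List.forall₂_cons,
          List.forall₂_cons] at hD
        rw [h2, h2', forall₂_append_iff (hi.trans hi'.symm), List.forall₂_cons]
        obtain ⟨d1, d2, d3, d4⟩ := hD
        refine ⟨d1, fun s hs1 hs2 => ?_, d4⟩
        have hne : q - p ≠ 0 := by linarith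
        -- Both halves have the same slope (q' - p') / (q - p), so the two affine formulas agree
        -- with the one on the merged interval.
        rcases le_total (s : ℝ) ((p + q) / 2) with hm | hm
        · rw [d2 s hs1 hm]
          dsimp only
          rw [show (p + q) / 2 - p = (q - p) / 2 by ring]
          field_simp
          ring
        · rw [d3 s hm hs2]
          dsimp only
          rw [show q - (p + q) / 2 = (q - p) / 2 by ring]
          field_simp
          ring) rfl
    exact ⟨D', hD', hw, hc.trans hlt.le⟩

/-- Existence of a reduced diagram with no more carets suffices, because `caretNumber` is an
infimum; uniqueness of the reduced diagram plays no role. -/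
theorem caretNumber_le {D : TreePair} {w : F} (hD : D.Represents w) : caretNumber w ≤ D.carets := by
  obtain ⟨D', h1, h2, h3⟩ := D.exists_reduced w hD
  have h4 : caretNumber w ≤ D'.carets := Nat.sInf_le ⟨D', h1, h2, rfl⟩
  exact h4.trans h3

/-! ### Subdivisions into standard dyadic intervals -/

/-- The intervals in the list are consecutive and lead from `a` to `b`. -/
def IsChain : List (ℝ × ℝ) → ℝ → ℝ → Prop
  | [], a, b => a = b
  | J :: L, a, b => J.1 = a ∧ IsChain L J.2 b

theorem IsChain.append {L M : List (ℝ × ℝ)} {a b c : ℝ} (hL : IsChain L a b)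
    (hM : IsChain M b c) : IsChain (L ++ M) a c := by
  induction L generalizing a with
  | nil => obtain rfl : a = b := hL; exact hM
  | cons J L ih => exact ⟨hL.1, ih hL.2⟩

theorem isChain_leafIntervals (t : BinaryTree Unit) (a b : ℝ) :
    IsChain (leafIntervals t a b) a b := by
  induction t generalizing a b with
  | nil => exact ⟨rfl, rfl⟩
  | node _ l r hl hr => exact (hl _ _).append (hr _ _)

theorem IsChain.bounds {L : List (ℝ × ℝ)} {a b : ℝ} (h : IsChain L a b)
    (hL : ∀ J ∈ L, J.1 < J.2) : a ≤ b ∧ ∀ J ∈ L, a ≤ J.1 ∧ J.2 ≤ b := by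
  induction L generalizing a with
  | nil => exact ⟨le_of_eq h, by simp⟩
  | cons J L ih =>
    obtain ⟨h1, h2⟩ := ih h.2 fun K hK => hL K (List.mem_cons_of_mem _ hK)
    have hJ := hL J List.mem_cons_self
    have ha := h.1
    refine ⟨by linarith, fun K hK => ?_⟩
    rcases List.mem_cons.1 hK with rfl | hK
    · exact ⟨ha.ge, h1⟩
    · exact ⟨by linarith [h2 K hK], (h2 K hK).2⟩

/-- A chain can be cut at a point that is not in the interior of one of its intervals. -/
theorem IsChain.exists_split {L : List (ℝ × ℝ)} {a b m : ℝ} (h : IsChain L a b) (ha : a ≤ m)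
    (hb : m ≤ b) (hL : ∀ J ∈ L, J.1 < J.2) (hm : ∀ J ∈ L, J.2 ≤ m ∨ m ≤ J.1) :
    ∃ L₁ L₂, L = L₁ ++ L₂ ∧ IsChain L₁ a m ∧ IsChain L₂ m b := by
  induction L generalizing a with
  | nil =>
    obtain rfl : a = b := h
    obtain rfl : a = m := le_antisymm ha hb
    exact ⟨[], [], rfl, rfl, rfl⟩
  | cons J L ih =>
    rcases hm J List.mem_cons_self with h' | h'
    · obtain ⟨L₁, L₂, rfl, h1, h2⟩ := ih h.2 h' (fun K hK => hL K (List.mem_cons_of_mem _ hK))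
        fun K hK => hm K (List.mem_cons_of_mem _ hK)
      exact ⟨J :: L₁, L₂, rfl, ⟨h.1, h1⟩, h2⟩
    · obtain rfl : a = m := le_antisymm ha (h'.trans h.1.le)
      exact ⟨[], J :: L, rfl, rfl, h⟩

theorem IsStandard.lt {J : ℝ × ℝ} (h : IsStandard J) : J.1 < J.2 := by
  obtain ⟨m, n, -, h1, h2⟩ := h
  rw [h1, h2]
  gcongr
  linarith

theorem IsStandard.nonneg {J : ℝ × ℝ} (h : IsStandard J) : 0 ≤ J.1 := by
  obtain ⟨m, n, -, h1, -⟩ := h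
  rw [h1]
  positivity

theorem IsStandard.le_one {J : ℝ × ℝ} (h : IsStandard J) : J.2 ≤ 1 := by
  obtain ⟨m, n, hm, -, h2⟩ := h
  rw [h2, div_le_one (by positivity)]
  exact_mod_cast hm

/-- A standard dyadic interval that is properly contained in another one lies in one of the two
halves of the latter. -/
theorem IsStandard.le_mid_or_mid_le {J K : ℝ × ℝ} (hJ : IsStandard J) (hK : IsStandard K)
    (h1 : K.1 ≤ J.1) (h2 : J.2 ≤ K.2) (hne : J ≠ K) :
    J.2 ≤ (K.1 + K.2) / 2 ∨ (K.1 + K.2) / 2 ≤ J.1 := by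
  obtain ⟨p, k, -, hp1, hp2⟩ := hJ
  obtain ⟨m, n, -, hm1, hm2⟩ := hK
  rcases le_or_gt k n with hkn | hkn
  -- Here `J` is at least as long as `K` and contained in it, so they coincide.
  · exfalso
    have hle : (1 : ℝ) / 2 ^ n ≤ 1 / 2 ^ k :=
      one_div_le_one_div_of_le (by positivity) (pow_le_pow_right₀ one_le_two hkn)
    rw [add_div] at hp2 hm2
    exact hne (Prod.ext (by linarith) (by linarith))
  -- Here `J` is strictly shorter, so the midpoint of `K` lies on the grid of mesh 2^(-k) and cannot
  -- be interior to `J`.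
  · obtain ⟨d, rfl⟩ := Nat.exists_eq_add_of_lt hkn
    have hmid : (K.1 + K.2) / 2 = (((2 * m + 1) * 2 ^ d : ℕ) : ℝ) / 2 ^ (n + d + 1) := by
      rw [hm1, hm2, pow_succ, pow_add]
      push_cast
      field_simp
      ring
    rw [hmid, hp1, hp2]
    rcases lt_or_ge p ((2 * m + 1) * 2 ^ d) with h | h
    · left
      gcongr
      exact_mod_cast h
    · right
      gcongr

/-- A chain of standard dyadic intervals that fills a standard dyadic interval consists of the
leaf intervals of a tree. -/
theorem exists_leafIntervals_eq {L : List (ℝ × ℝ)} {a b : ℝ} (hab : IsStandard (a, b))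
    (h : IsChain L a b) (hL : ∀ J ∈ L, IsStandard J) :
    ∃ t : BinaryTree Unit, leafIntervals t a b = L := by
  induction hn : L.length using Nat.strong_induction_on generalizing L a b with
  | _ n ih =>
    have hlt : ∀ J ∈ L, J.1 < J.2 := fun J hJ => (hL J hJ).lt
    have hab' : a < b := hab.lt
    by_cases hmem : (a, b) ∈ L
    · obtain ⟨L₁, L₂, rfl⟩ := List.append_of_mem hmem
      have hbd := (h.bounds hlt).2
      refine ⟨.nil, ?_⟩
      cases L₁ with
      | nil =>
        cases L₂ with
        | nil => rfl
        | cons J L₂ =>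
          have h1 := hbd J (by simp)
          have h2 := hlt J (by simp)
          have h3 : J.1 = b := h.2.1
          linarith
      | cons J L₁ =>
        have h1 := ((h.2.bounds fun K hK => hlt K (List.mem_cons_of_mem _ hK)).2 (a, b) (by simp)).1
        have h2 := hlt J (by simp)
        have h3 : J.1 = a := h.1
        dsimp only at h1
        linarith
    · obtain ⟨L₁, L₂, rfl, h1, h2⟩ := h.exists_split (m := (a + b) / 2) (by linarith) (by linarith)
        hlt fun J hJ => (hL J hJ).le_mid_or_mid_le hab ((h.bounds hlt).2 J hJ).1
          ((h.bounds hlt).2 J hJ).2 fun hJ' => hmem (hJ' ▸ hJ)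
      rw [List.length_append] at hn
      -- An empty part would force the midpoint to be an endpoint; so both parts are nonempty, hence
      -- shorter than the whole chain.
      have hpos₁ : 0 < L₁.length := by
        rcases L₁ with _ | _
        · have : a = (a + b) / 2 := h1
          linarith
        · simp
      have hpos₂ : 0 < L₂.length := by
        rcases L₂ with _ | _
        · have : (a + b) / 2 = b := h2
          linarith
        · simp
      obtain ⟨t₁, ht₁⟩ := ih _ (by omega) hab.left_half h1
        (fun J hJ => hL J (List.mem_append_left _ hJ)) rfl
      obtain ⟨t₂, ht₂⟩ := ih _ (by omega) hab.right_half h2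
        (fun J hJ => hL J (List.mem_append_right _ hJ)) rfl
      exact ⟨.node () t₁ t₂, by rw [leafIntervals, ht₁, ht₂]⟩

theorem leafIntervals_lt {t : BinaryTree Unit} {a b : ℝ} (hab : a < b) :
    ∀ K ∈ leafIntervals t a b, K.1 < K.2 := by
  induction t generalizing a b with
  | nil => simpa [leafIntervals] using hab
  | node _ l r hl hr =>
    simp only [leafIntervals, List.forall_mem_append]
    exact ⟨hl (by linarith), hr (by linarith)⟩

/-! ### From trees for elements of `T` to tree pair diagrams -/

/-- If `w ∈ F`, then an affine piece of `w` on the circle is an affine piece of `w` on `[0, 1]`. -/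
theorem MapsAffinely.apply_eq {w : F} {a b a' b' : ℝ}
    (h : MapsAffinely (Thompson.inclusion w) a b a' b') (ha : 0 ≤ a) (hab : a < b) (hb : b ≤ 1) (ha' : 0 ≤ a') (hab' : a' < b')
    (hb' : b' ≤ 1) (s : I) (h1 : a ≤ s) (h2 : s ≤ b) :
    ((w : I ≃ₜ I) s : ℝ) = a' + (b' - a') / (b - a) * (s - a) := by
  have hba : 0 < b - a := by linarith
  set u : ℝ := (s - a) / (b - a) with hu
  have hus : a + (b - a) * u = s := by rw [hu]; field_simp; ring
  have hu0 : 0 ≤ u := div_nonneg (by linarith) hba.le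
  have hu1 : u ≤ 1 := (div_le_one hba).2 (by linarith)
  have key := h u ⟨hu0, hu1⟩
  rw [hus, glue_coe] at key
  rw [div_mul_eq_mul_div, mul_div_assoc, ← hu]
  have hm0 : 0 ≤ (b' - a') * u := mul_nonneg (by linarith) hu0
  have hm1 : (b' - a') * u ≤ b' - a' := mul_le_of_le_one_right (by linarith) hu1
  obtain ⟨hw0, hw1⟩ := ((w : I ≃ₜ I) s).2
  -- Equality on the circle is lifted through a fundamental domain: `[0, 1)` away from the right
  -- end, and `(0, 1]` at it, where the value may be 1.
  rcases h2.lt_or_eq with h2 | h2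
  · have hs1 : (s : ℝ) < (1 : I) := h2.trans_le hb
    have hws : (w : I ≃ₜ I) s < 1 := by
      rw [← F.map_one w]
      exact w.2.1 hs1
    have hu1' : u < 1 := (div_lt_one hba).2 (by linarith)
    have hm1' : (b' - a') * u < b' - a' := mul_lt_of_lt_one_right (by linarith) hu1'
    exact (AddCircle.coe_eq_coe_iff_of_mem_Ico (p := 1) (a := 0)
      ⟨hw0, by simpa using hws⟩ ⟨by linarith, by linarith⟩).1 key
  · have hs0 : ((0 : I) : ℝ) < s := ha.trans_lt (by linarith)
    have hws : 0 < (w : I ≃ₜ I) s := by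
      rw [← F.map_zero w]
      exact w.2.1 hs0
    have hws' : (0 : ℝ) < (w : I ≃ₜ I) s := hws
    have hu1' : u = 1 := by rw [hu, h2, div_self hba.ne']
    exact (AddCircle.coe_eq_coe_iff_of_mem_Ioc (p := 1) (a := 0)
      ⟨hws', by linarith⟩ ⟨by rw [hu1']; linarith, by linarith⟩).1 key

/-- By injectivity of `w`, source intervals whose images abut must abut themselves. -/
theorem IsChain.pullback {w : F} {L M : List (ℝ × ℝ)} {a b p q : I} (hM : IsChain M p q)
    (ha : (w : I ≃ₜ I) a = p) (hb : (w : I ≃ₜ I) b = q)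
    (h : List.Forall₂ (fun J K : ℝ × ℝ => ∃ s t : I, (s : ℝ) = J.1 ∧ (t : ℝ) = J.2 ∧
      ((w : I ≃ₜ I) s : ℝ) = K.1 ∧ ((w : I ≃ₜ I) t : ℝ) = K.2) L M) : IsChain L a b := by
  induction h generalizing a p with
  | nil =>
    have h1 : p = q := Subtype.ext hM
    exact congrArg Subtype.val ((w : I ≃ₜ I).injective (ha.trans (h1.trans hb.symm)))
  | cons hJ _ ih =>
    obtain ⟨s, t, hs, ht, hs', ht'⟩ := hJ
    have h1 : s = a := (w : I ≃ₜ I).injective (Subtype.ext (by rw [hs', ha]; exact hM.1))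
    refine ⟨by rw [← hs, h1], ?_⟩
    rw [← ht]
    exact ih (p := (w : I ≃ₜ I) t) (by rw [ht']; exact hM.2) rfl

/-- The source intervals of the leaves of `R` are standard and, because `w` lies in F, they
subdivide `[0, 1]` in order. They are thus the leaves of a source tree `S`, and `(S, R)` is a
possibly unreduced diagram of `w`. -/
theorem caretNumber_le_of_fits {w : F} {R : BinaryTree Unit} (h : Fits (inclusion w) R 0 1) :
    caretNumber w ≤ R.numNodes := by
  choose! φ hφ hmaps using h
  have hKlt := leafIntervals_lt (t := R) one_pos
  have hKbd := ((isChain_leafIntervals R 0 1).bounds hKlt).2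
  have happly : ∀ K ∈ leafIntervals R 0 1, ∀ s : I, (φ K).1 ≤ s → (s : ℝ) ≤ (φ K).2 →
      ((w : I ≃ₜ I) s : ℝ) = K.1 + (K.2 - K.1) / ((φ K).2 - (φ K).1) * (s - (φ K).1) :=
    fun K hK => (hmaps K hK).apply_eq (hφ K hK).nonneg (hφ K hK).lt (hφ K hK).le_one
      (hKbd K hK).1 (hKlt K hK) (hKbd K hK).2
  have hchain : IsChain ((leafIntervals R 0 1).map φ) (0 : I) (1 : I) := by
    refine IsChain.pullback (w := w) (p := 0) (q := 1)
      (by simpa using isChain_leafIntervals R 0 1) (F.map_zero w) (F.map_one w) ?_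
    rw [List.forall₂_map_left_iff, List.forall₂_same]
    intro K hK
    have h1 := (hφ K hK).nonneg
    have h2 := (hφ K hK).lt
    have h3 := (hφ K hK).le_one
    refine ⟨⟨(φ K).1, h1, by linarith⟩, ⟨(φ K).2, by linarith, h3⟩, rfl, rfl, ?_, ?_⟩
    · rw [happly K hK _ le_rfl h2.le]
      simp
    · rw [happly K hK _ h2.le le_rfl, div_mul_cancel₀ _ (by simpa [sub_eq_zero] using h2.ne')]
      ring
  obtain ⟨S, hS⟩ := exists_leafIntervals_eq (L := (leafIntervals R 0 1).map φ)
    (a := 0) (b := 1) ⟨0, 0, by simp⟩ (by simpa using hchain)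
    (by simpa only [List.forall_mem_map] using hφ)
  have hnum : S.numLeaves = R.numLeaves := by
    rw [← length_leafIntervals S 0 1, hS, List.length_map, length_leafIntervals]
  have hrep : (TreePair.mk S R hnum).Represents w := by
    unfold TreePair.Represents
    rw [hS, List.forall₂_map_left_iff, List.forall₂_same]
    exact happly
  refine (caretNumber_le hrep).trans ?_
  rw [numLeaves_eq_numNodes_succ, numLeaves_eq_numNodes_succ] at hnum
  exact (Nat.succ_injective hnum).le

end Thompson

/-! ### Comparison of the two word lengths -/

theorem theorem4p3 (w : Thompson.F)
    (hw : Thompson.wordLength {Thompson.x₀, Thompson.x₁} w + 1 ≤ (Thompson.caretNumber w : ℕ∞)) :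
    Thompson.wordLength
        {Thompson.inclusion Thompson.x₀, Thompson.inclusion Thompson.x₁, Thompson.c₀}
        (Thompson.inclusion w) =
      Thompson.wordLength {Thompson.x₀, Thompson.x₁} w := by
  apply le_antisymm
  · refine le_iInf₂ fun l hl => ?_
    refine (iInf₂_le (l.map Thompson.inclusion) ⟨?_, ?_⟩).trans (by simp)
    · intro s hs
      obtain ⟨f, hf, rfl⟩ := List.mem_map.1 hs
      rcases hl.1 f hf with (h | h) | (h | h)
      · exact Or.inl (Or.inl (congrArg _ h))
      · exact Or.inl (Or.inr (Or.inl (congrArg _ h)))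
      · exact Or.inr (Or.inl (by rw [← map_inv]; exact congrArg _ h))
      · exact Or.inr (Or.inr (Or.inl (by rw [← map_inv]; exact congrArg _ h)))
    · rw [← map_list_prod, hl.2]
  · refine le_iInf₂ fun l hl => ?_
    obtain ⟨A, B, hAB, -, hcase⟩ := Thompson.exists_tree_of_word l hl.1
    rw [hl.2] at hAB hcase
    rcases hcase with ⟨l', hl', rfl⟩ | ⟨h0, -⟩ | hc
    · rw [List.length_map]
      refine iInf₂_le l' ⟨hl', Thompson.inclusion_injective ?_⟩
      rw [map_list_prod, hl.2]
    -- This case cannot occur, since an element of F fixes 0.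
    · exact absurd (Thompson.inclusion_zero w) h0
    -- With a letter saved, |w|_F + 1 ≤ N(w) ≤ n + 1 for a word of length n; without the saving the
    -- last bound would be n + 2, too weak by one.
    · have h1 := Thompson.caretNumber_le_of_fits hAB
      have h2 : Thompson.caretNumber w ≤ l.length + 1 := by
        refine h1.trans (le_trans ?_ hc)
        simp only [BinaryTree.numNodes, Thompson.complexity]
        omega
      have h3 := hw.trans (Nat.cast_le.2 h2)
      push_cast at h3
      exact (ENat.add_le_add_iff_right ENat.one_ne_top).1 h3
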